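/- Let $(\Omega,\Sigma,P)$ be a probability space, $\Theta$ a random vector on $\Omega$ with values in $D\subseteq\mathbb R^d$, and $\mathfrak B(D)$ the Borel $\sigma$-algebra of $D$. Let $N=\{N_t\}_{t\ge 0}$ be a counting process on $\Omega$: its paths take values in $\mathbb N_0\cup\{\infty\}$, vanish at $0$, increase to infinity, are right-continuous and have jumps of size at most one. Let $T_n=\inf\{t\ge0: N_t=n\}$ and $W_n=T_n-T_{n-1}$ ($n\ge 1$) be its arrival and interarrival times. Let $X=\{X_n\}_{n\ge1}$ be a sequence of positive real random variables, $S_t=\sum_{k=1}^{N_t}X_k\in[0,\infty]$, $\mathcal F_t=\sigma(\{S_s:s\le t\}\cup\{\Theta\})$ for $t\ge0$, and $\mathcal F_\infty=\sigma(\{S_s:s\ge 0\}\cup\{\Theta\})$. For a probability measure $R$ on $\Sigma$ and a Markov kernel $\theta\mapsto\mathbf K(\theta)$ from $(D,\mathfrak B(D))$ to $\mathbb R$, say that $S$ is an $R$-compound mixed renewal process with parameter $\mathbf K(\Theta)$ if $X$ is $R$-i.i.d., $N$ and $X$ are $R$-independent, the sequence $W=\{W_n\}_{n\geq 1}$ is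 $R$-conditionally independent given $\Theta$, and for every $n$ the conditional distribution of $W_n$ given $\Theta$ under $R$ is $\mathbf K(\Theta)$. Let $\mathcal M_{S,\mathbf K(\Theta)}$ be the class of all probability measures $R$ on $\Sigma$ such that $W$ and $X$ are $R$-conditionally independent given $\Theta$; $\Theta$ and $X$ are $R$-independent; $R$ and $P$ have the same null sets in $\mathcal F_t$ for each $t\ge0$; and $S$ is an $R$-compound mixed renewal process with parameter $\mathbf K(\Theta)$. Write $R_\Theta$ for the law of $\Theta$ under $R$. A family $\{R_\theta\}_{\theta\in D}$ of probability measures on $\Sigma$ is a regular conditional probability (rcp) of $R$ over $R_\Theta$ consistent with $\Theta$ if $\theta\mapsto R_\theta(E)$ is $\mathfrak B(D)$-measurable and $\int R_\theta(E)\,R_\Theta(d\theta)=R(E)$ for each $E\in\Sigma$, and for each $B\in\mathfrak B(D)$ one has $R_\theta(\Theta^{-1}(B))=1$ for $R_\Theta$-a.e. $\theta\in B$. Let $P\in\mathcal M_{S,\mathbf K(\Theta)}$ for a Markov kernel $\mathbf K$ from $D$ to $\mathbb R$, and let $\{P_\theta\}_{\theta\in D}$ be an rcp of $P$ over $P_\Theta$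 consistent with $\Theta$. Let $D'\subseteq\mathbb R^k$, let $\mathbf\Lambda$ be a Markov kernel from $D'$ to $\mathbb R$ and $\rho:D\to D'$ a Borel measurable map, let $Q\in\mathcal M_{S,\mathbf\Lambda(\rho(\Theta))}$, and let $\{Q_\theta\}_{\theta\in D}$ be an rcp of $Q$ over $Q_\Theta$ consistent with $\Theta$. Then: (i) if $P_\theta$ and $Q_\theta$ coincide on $\mathcal F_\infty$ for $P_\Theta$-a.e. $\theta$, then $P$ and $Q$ are equivalent on $\mathcal F_\infty$, i.e. they have the same null sets in $\mathcal F_\infty$; (ii) if $P_\theta$ and $Q_\theta$ do not coincide on $\mathcal F_\infty$ for $P_\Theta$-a.e. $\theta$ (that is, for $P_\Theta$-a.e. $\theta$ there is $A\in\mathcal F_\infty$ with $P_\theta(A)\ne Q_\theta(A)$), then $P$ and $Q$ are mutually singular on $\mathcal F_\infty$, i.e. there is $E\in\mathcal F_\infty$ with $P(E)=0$ and $Q(E)=1$. -/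

import Mathlib

open MeasureTheory ProbabilityTheory Filter Topology
open scoped NNReal ENNReal

noncomputable section

namespace CMRP

/-- A counting process: for every `ω`, the path is `ℕ₀ ∪ {∞}`-valued, vanishes at `0`, increases to
infinity, is right-continuous and has jumps of size at most one. -/
structure IsCountingProcess {Ω : Type*} [MeasurableSpace Ω] (N : ℝ≥0 → Ω → ℕ∞) : Prop where
  measurable : ∀ t, Measurable (N t)
  zero : ∀ ω, N 0 ω = 0
  mono : ∀ ω, Monotone (fun t => N t ω)
  rightCts : ∀ ω t, ContinuousWithinAt (fun s => N s ω) (Set.Ici t) t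
  jump_le_one : ∀ ω t, N t ω ≤ (⨆ s : Set.Iio t, N s ω) + 1
  tendsto : ∀ ω, Tendsto (fun t => N t ω) atTop (𝓝 ⊤)

/-- The arrival times `T₀, T₁, …` of `N`. -/
def arrival {Ω : Type*} (N : ℝ≥0 → Ω → ℕ∞) (n : ℕ) (ω : Ω) : ℝ≥0 :=
  sInf {t : ℝ≥0 | N t ω = n}

/-- The interarrival times of `N`, numbered from `0`: `interarrival N n = T_{n+1} - T_n`. -/
def interarrival {Ω : Type*} (N : ℝ≥0 → Ω → ℕ∞) (n : ℕ) (ω : Ω) : ℝ :=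
  (arrival N (n + 1) ω : ℝ) - (arrival N n ω : ℝ)

/-- A claim size process: a sequence (numbered from `0`) of positive real random variables. -/
structure IsClaimSizeProcess {Ω : Type*} [MeasurableSpace Ω] (X : ℕ → Ω → ℝ) : Prop where
  measurable : ∀ n, Measurable (X n)
  pos : ∀ n ω, 0 < X n ω

/-- The aggregate claims process: `S_t` is the sum of the first `N_t` claim sizes. It takes values
in `[0, ∞]`, since `N_t = ∞` is not excluded pathwise. -/
def aggregate {Ω : Type*} (N : ℝ≥0 → Ω → ℕ∞) (X : ℕ → Ω → ℝ) (t : ℝ≥0) (ω : Ω) : ℝ≥0∞ :=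
  ∑' k : ℕ, if (k : ℕ∞) < N t ω then ENNReal.ofReal (X k ω) else 0

/-- `σ(f)`. -/
abbrev sigmaOf {Ω E : Type*} [mE : MeasurableSpace E] (f : Ω → E) : MeasurableSpace Ω :=
  MeasurableSpace.comap f mE

/-- The canonical filtration `𝓕^S_t = σ(S_s : s ≤ t)`. -/
abbrev filtS {Ω : Type*} (S : ℝ≥0 → Ω → ℝ≥0∞) (t : ℝ≥0) : MeasurableSpace Ω :=
  ⨆ s : Set.Iic t, sigmaOf (S s)

/-- `𝓕_t = σ(𝓕^S_t ∪ σ(Θ))`. -/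
abbrev filt {Ω 𝓓 : Type*} [MeasurableSpace 𝓓] (S : ℝ≥0 → Ω → ℝ≥0∞) (Θ : Ω → 𝓓) (t : ℝ≥0) :
    MeasurableSpace Ω :=
  filtS S t ⊔ sigmaOf Θ

/-- `𝓕_∞ = σ(𝓕^S_∞ ∪ σ(Θ))`, where `𝓕^S_∞ = σ(⋃_t 𝓕^S_t)`. -/
abbrev filtInf {Ω 𝓓 : Type*} [MeasurableSpace 𝓓] (S : ℝ≥0 → Ω → ℝ≥0∞) (Θ : Ω → 𝓓) :
    MeasurableSpace Ω :=
  (⨆ t, filtS S t) ⊔ sigmaOf Θ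

/-- A version of the conditional probability `P(A ∣ σ(Θ))`. -/
def condProb {Ω 𝓓 : Type*} [MeasurableSpace Ω] [MeasurableSpace 𝓓] (P : Measure Ω) (Θ : Ω → 𝓓)
    (A : Set Ω) : Ω → ℝ :=
  condExp (sigmaOf Θ) P (A.indicator (fun _ => (1 : ℝ)))

/-- The sequence `V` is `P`-conditionally independent given `Θ`. -/
def CondIndepSeq {Ω 𝓓 : Type*} [MeasurableSpace Ω] [MeasurableSpace 𝓓] (P : Measure Ω)
    (Θ : Ω → 𝓓) (V : ℕ → Ω → ℝ) : Prop :=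
  ∀ (n : ℕ) (v : Fin n → ℝ),
    condProb P Θ (⋂ k : Fin n, {ω | V k ω ≤ v k})
      =ᵐ[P] fun ω => ∏ k : Fin n, condProb P Θ {ω' | V k ω' ≤ v k} ω

/-- The processes `V` and `U` are `P`-conditionally independent of each other given `Θ`. -/
def CondIndepPair {Ω 𝓓 : Type*} [MeasurableSpace Ω] [MeasurableSpace 𝓓] (P : Measure Ω)
    (Θ : Ω → 𝓓) (V U : ℕ → Ω → ℝ) : Prop :=
  ∀ A B : Set (ℕ → ℝ), MeasurableSet A → MeasurableSet B →
    condProb P Θ ({ω | (fun n => V n ω) ∈ A} ∩ {ω | (fun n => U n ω) ∈ B})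
      =ᵐ[P] fun ω => condProb P Θ {ω' | (fun n => V n ω') ∈ A} ω
        * condProb P Θ {ω' | (fun n => U n ω') ∈ B} ω

/-- `N` is a `P`-mixed renewal process with mixing parameter `Θ` and interarrival time conditional
distribution `K(Θ)`. -/
structure IsMRP {Ω 𝓓 : Type*} [MeasurableSpace Ω] [MeasurableSpace 𝓓] (P : Measure Ω)
    (N : ℝ≥0 → Ω → ℕ∞) (Θ : Ω → 𝓓) (K : Kernel 𝓓 ℝ) : Prop where
  counting : IsCountingProcess N
  condIndep : CondIndepSeq P Θ (interarrival N)
  condDistrib : ∀ (n : ℕ) (B : Set ℝ), MeasurableSet B →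
    condProb P Θ (interarrival N n ⁻¹' B) =ᵐ[P] fun ω => (K (Θ ω)).real B

/-- `(N, X)` is a `P`-risk process. -/
structure IsRiskProcess {Ω : Type*} [MeasurableSpace Ω] (P : Measure Ω)
    (N : ℝ≥0 → Ω → ℕ∞) (X : ℕ → Ω → ℝ) : Prop where
  counting : IsCountingProcess N
  claims : IsClaimSizeProcess X
  indep : iIndepFun X P
  identDistrib : ∀ n, IdentDistrib (X n) (X 0) P P
  indepNX : IndepFun (fun ω t => N t ω) (fun ω n => X n ω) P

/-- The aggregate claims process induced by `(N, X)` is a `P`-compound mixed renewal process with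
parameters `K(Θ)` and `P_{X₁}`. -/
def IsCMRP {Ω 𝓓 : Type*} [MeasurableSpace Ω] [MeasurableSpace 𝓓] (P : Measure Ω)
    (N : ℝ≥0 → Ω → ℕ∞) (X : ℕ → Ω → ℝ) (Θ : Ω → 𝓓) (K : Kernel 𝓓 ℝ) : Prop :=
  IsRiskProcess P N X ∧ IsMRP P N Θ K

/-- `P` and `Q` are equivalent (have the same null sets) on the `σ`-algebra `𝓖`. -/
def EquivOn {Ω : Type*} {mΩ : MeasurableSpace Ω} (P Q : Measure Ω) (𝓖 : MeasurableSpace Ω) : Prop :=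
  ∀ A, MeasurableSet[𝓖] A → (P A = 0 ↔ Q A = 0)

/-- The probability measures `P` and `Q` are mutually singular on the `σ`-algebra `𝓖`. -/
def SingularOn {Ω : Type*} {mΩ : MeasurableSpace Ω} (P Q : Measure Ω) (𝓖 : MeasurableSpace Ω) : Prop :=
  ∃ E, MeasurableSet[𝓖] E ∧ P E = 0 ∧ Q E = 1

/-- `P` and `Q` coincide on the `σ`-algebra `𝓖`. -/
def EqOn {Ω : Type*} {mΩ : MeasurableSpace Ω} (P Q : Measure Ω) (𝓖 : MeasurableSpace Ω) : Prop :=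
  ∀ A, MeasurableSet[𝓖] A → P A = Q A

/-- `Q` belongs to the class `𝓜_{S,K(Θ)}` relative to the reference measure `P`. -/
structure MemClass {Ω 𝓓 : Type*} [MeasurableSpace Ω] [MeasurableSpace 𝓓] (P : Measure Ω)
    (N : ℝ≥0 → Ω → ℕ∞) (X : ℕ → Ω → ℝ) (Θ : Ω → 𝓓) (K : Kernel 𝓓 ℝ) (Q : Measure Ω) : Prop where
  isProb : IsProbabilityMeasure Q
  condIndepWX : CondIndepPair Q Θ (interarrival N) X
  indepThetaX : IndepFun Θ (fun ω n => X n ω) Q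
  progressivelyEquiv : ∀ t, EquivOn P Q (filt (aggregate N X) Θ t)
  cmrp : IsCMRP Q N X Θ K

/-- `κ = (P_θ)_θ` is a regular conditional probability of `P` over the law of `Θ` under `P`,
consistent with `Θ`. -/
structure IsConsistentRCP {Ω 𝓓 : Type*} [MeasurableSpace Ω] [MeasurableSpace 𝓓] (P : Measure Ω)
    (Θ : Ω → 𝓓) (κ : 𝓓 → Measure Ω) : Prop where
  isProb : ∀ θ, IsProbabilityMeasure (κ θ)
  measurable : ∀ E, MeasurableSet E → Measurable (fun θ => κ θ E)
  disintegrates : ∀ E, MeasurableSet E → ∫⁻ θ, κ θ E ∂(P.map Θ) = P E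
  consistent : ∀ B, MeasurableSet B → ∀ᵐ θ ∂(P.map Θ), θ ∈ B → κ θ (Θ ⁻¹' B) = 1

end CMRP

end

/-! Since `Θ` is measurable at time `0`, progressive equivalence makes its laws under `P` and `Q`
equivalent. Part (i) follows: a set is null for a measure exactly when it is null under almost every
member of the disintegration (`IsConsistentRCP.measure_eq_zero_iff`, `equivOn_of_ae_eqOn`).

For (ii), under almost every `κP θ` the parameter equals `θ`, the interarrival times are i.i.d. with
law `K θ`, the claims are i.i.d. with law `P.map (X 0)`, and the two sequences are independent
(`ae_map_eq_prod_dirac`). As 𝓕_∞ lies in the σ-algebra of these data, the restriction of `κP θ` to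
it depends only on `θ`, `K θ` and the claim law; likewise for `κQ θ`, with `L` = `Λ.comap ρ hρ` in
place of `K`. If the disintegrations differ almost everywhere, then either the claim laws differ or
`K θ ≠ L θ` for almost every `θ`.

The strong law (`ae_hasEmpiricalLaw`) recovers these laws from one path, so the event that the
claims, respectively the interarrival times, have the empirical law prescribed by `P` has
probability one under `P` and zero under `Q`. It belongs to 𝓕_∞ because claims are positive: every
arrival is a visible jump of the aggregate process, which therefore determines both sequences. -/

noncomputable section

namespace CMRP

/-! ### Pathwise relations between counting process, arrivals and aggregate claims. -/

section Paths

variable {Ω : Type*} {N : ℝ≥0 → Ω → ℕ∞} {X : ℕ → Ω → ℝ}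

/-- The sum of the first `n` claims. -/
def claimSum (X : ℕ → Ω → ℝ) (n : ℕ) (ω : Ω) : ℝ≥0∞ :=
  ∑ k ∈ Finset.range n, ENNReal.ofReal (X k ω)

lemma claimSum_succ (X : ℕ → Ω → ℝ) (n : ℕ) (ω : Ω) :
    claimSum X (n + 1) ω = claimSum X n ω + ENNReal.ofReal (X n ω) :=
  Finset.sum_range_succ _ _

lemma claimSum_ne_top (X : ℕ → Ω → ℝ) (n : ℕ) (ω : Ω) : claimSum X n ω ≠ ∞ := by
  simp [claimSum]

lemma aggregate_eq_claimSum {n : ℕ} {t : ℝ≥0} {ω : Ω} (h : N t ω = n) :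
    aggregate N X t ω = claimSum X n ω := by
  rw [aggregate, claimSum, tsum_eq_sum (s := Finset.range n)]
  · exact Finset.sum_congr rfl fun k hk => by simp [h, Finset.mem_range.1 hk]
  · intro k hk
    simp [h, Finset.mem_range.not.1 hk]

lemma aggregate_mono_of_le {s t : ℝ≥0} {ω : Ω} (h : N s ω ≤ N t ω) :
    aggregate N X s ω ≤ aggregate N X t ω := by
  refine ENNReal.tsum_le_tsum fun k => ?_
  by_cases hk : (k : ℕ∞) < N s ω
  · rw [if_pos hk, if_pos (hk.trans_le h)]
  · simp [hk]

variable {mΩ : MeasurableSpace Ω}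

/-- The first time at which the level `n` is reached is the first time at which it is attained. -/
lemma IsCountingProcess.exists_first_passage (hN : IsCountingProcess N) (n : ℕ) (ω : Ω) :
    ∃ τ : ℝ≥0, N τ ω = n ∧ ∀ t, (n : ℕ∞) ≤ N t ω → τ ≤ t := by
  have hne : {t | (n : ℕ∞) ≤ N t ω}.Nonempty := by
    have h := (hN.tendsto ω).eventually (lt_mem_nhds (ENat.natCast_lt_top n))
    obtain ⟨t, ht⟩ := h.exists
    exact ⟨t, ht.le⟩
  set τ := sInf {t | (n : ℕ∞) ≤ N t ω} with hτ
  have hle : ∀ t, (n : ℕ∞) ≤ N t ω → τ ≤ t := fun t ht => csInf_le (OrderBot.bddBelow _) ht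
  -- Right-continuity: a level below `n` at `τ` would persist on some `[τ, u)`, against the choice
  -- of `τ` as an infimum.
  have hge : (n : ℕ∞) ≤ N τ ω := by
    by_contra! hlt
    have h := (hN.rightCts ω τ).eventually (gt_mem_nhds hlt)
    obtain ⟨u, hu, hsub⟩ := mem_nhdsGE_iff_exists_Ico_subset.1 h
    obtain ⟨t, ht, htu⟩ := exists_lt_of_csInf_lt hne (show τ < u from hu)
    exact absurd (hsub ⟨hle t ht, htu⟩) (by simpa using ht)
  refine ⟨τ, le_antisymm ?_ hge, hle⟩
  -- A positive level `m + 1` is not overshot, because the path is at most `m` before `τ` and jumps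
  -- by at most one. Level `0` has no predecessor and uses the initial value.
  rcases n with _ | m
  · have h0 : τ = 0 := le_antisymm (hle 0 (by simp)) zero_le
    simp [h0, hN.zero]
  · refine (hN.jump_le_one ω τ).trans ?_
    push_cast
    gcongr
    refine iSup_le fun s => ?_
    have hs : N s ω < ((m + 1 : ℕ) : ℕ∞) := lt_of_not_ge fun h => absurd (hle _ h) (not_le.2 s.2)
    exact Order.le_of_lt_add_one (by exact_mod_cast hs)

/-- No level is skipped, so the infimum defining `arrival` is over a nonempty set and is attained;
the default value `sInf ∅ = 0` never enters. -/
lemma IsCountingProcess.apply_arrival (hN : IsCountingProcess N) (n : ℕ) (ω : Ω) :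
    N (arrival N n ω) ω = n := by
  obtain ⟨τ, h1, h2⟩ := hN.exists_first_passage n ω
  have : arrival N n ω = τ :=
    le_antisymm (csInf_le (OrderBot.bddBelow _) h1) (le_csInf ⟨τ, h1⟩ fun t ht => h2 t (le_of_eq ht.symm))
  rw [this, h1]

lemma IsCountingProcess.arrival_le_iff (hN : IsCountingProcess N) (n : ℕ) (ω : Ω) (t : ℝ≥0) :
    arrival N n ω ≤ t ↔ (n : ℕ∞) ≤ N t ω := by
  refine ⟨fun h => (hN.apply_arrival n ω).symm.le.trans (hN.mono ω h), fun h => ?_⟩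
  obtain ⟨τ, h1, h2⟩ := hN.exists_first_passage n ω
  exact (csInf_le (OrderBot.bddBelow {t | N t ω = n}) h1).trans (h2 t h)

lemma IsCountingProcess.arrival_lt_arrival_succ (hN : IsCountingProcess N) (n : ℕ) (ω : Ω) :
    arrival N n ω < arrival N (n + 1) ω := by
  rw [← not_le, hN.arrival_le_iff, hN.apply_arrival]
  exact_mod_cast Nat.not_succ_le_self n

lemma IsCountingProcess.arrival_zero (hN : IsCountingProcess N) (ω : Ω) : arrival N 0 ω = 0 :=
  le_antisymm ((hN.arrival_le_iff 0 ω 0).2 (by simp)) zero_le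

lemma IsCountingProcess.sum_interarrival (hN : IsCountingProcess N) (n : ℕ) (ω : Ω) :
    ∑ k ∈ Finset.range n, interarrival N k ω = arrival N n ω := by
  simp only [interarrival]
  rw [Finset.sum_range_sub (fun k => (arrival N k ω : ℝ)), hN.arrival_zero]
  simp

lemma claimSum_lt_succ (hX : ∀ n ω, 0 < X n ω) (n : ℕ) (ω : Ω) :
    claimSum X n ω < claimSum X (n + 1) ω := by
  rw [claimSum_succ]
  exact ENNReal.lt_add_right (claimSum_ne_top X n ω) (by simpa using hX n ω)

lemma claimSum_le_aggregate (hN : IsCountingProcess N) {n : ℕ} {t : ℝ≥0} {ω : Ω}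
    (h : (n : ℕ∞) ≤ N t ω) : claimSum X n ω ≤ aggregate N X t ω := by
  rw [← aggregate_eq_claimSum (hN.apply_arrival n ω)]
  exact aggregate_mono_of_le (by rwa [hN.apply_arrival])

/-- Positivity of the claims makes the partial sums strictly increasing, so the value of the
aggregate reveals how many claims have occurred. -/
lemma claimSum_lt_aggregate_iff (hN : IsCountingProcess N) (hX : ∀ n ω, 0 < X n ω)
    (n : ℕ) (t : ℝ≥0) (ω : Ω) :
    claimSum X n ω < aggregate N X t ω ↔ ((n + 1 : ℕ) : ℕ∞) ≤ N t ω := by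
  refine ⟨fun h => ?_, fun h => (claimSum_lt_succ hX n ω).trans_le (claimSum_le_aggregate hN h)⟩
  by_contra! hlt
  have hle : N t ω ≤ n := Order.le_of_lt_add_one (by exact_mod_cast hlt)
  refine absurd h (not_lt.2 ?_)
  rw [← aggregate_eq_claimSum (hN.apply_arrival n ω)]
  exact aggregate_mono_of_le (by rwa [hN.apply_arrival])

/-- The next partial sum is the smallest aggregate value above the current one. Countably many times
suffice, since a dense sequence meets the open interval between two successive arrivals, where the
infimum is attained. -/
lemma claimSum_succ_eq_iInf (hN : IsCountingProcess N) (hX : ∀ n ω, 0 < X n ω)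
    (n : ℕ) (ω : Ω) :
    claimSum X (n + 1) ω = ⨅ i : ℕ,
      if claimSum X n ω < aggregate N X (TopologicalSpace.denseSeq ℝ≥0 i) ω then
        aggregate N X (TopologicalSpace.denseSeq ℝ≥0 i) ω else ∞ := by
  refine le_antisymm (le_iInf fun i => ?_) ?_
  · split_ifs with h
    · exact claimSum_le_aggregate hN ((claimSum_lt_aggregate_iff hN hX n _ ω).1 h)
    · exact le_top
  · obtain ⟨_, ⟨i, rfl⟩, h1, h2⟩ := (TopologicalSpace.denseRange_denseSeq ℝ≥0).exists_between
      (hN.arrival_lt_arrival_succ (n + 1) ω)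
    have hge := (hN.arrival_le_iff _ ω _).1 h1.le
    have hlt := not_le.1 ((hN.arrival_le_iff _ ω _).not.1 (not_le.2 h2))
    have heq : N (TopologicalSpace.denseSeq ℝ≥0 i) ω = (n + 1 : ℕ) :=
      le_antisymm (Order.le_of_lt_add_one (by exact_mod_cast hlt)) hge
    refine (iInf_le _ i).trans ?_
    rw [if_pos ((claimSum_lt_aggregate_iff hN hX n _ ω).2 hge), aggregate_eq_claimSum heq]

/-- The aggregate claims as a function of the interarrival times and of the claim sizes. -/
def aggregateOfSeq (t : ℝ≥0) (p : (ℕ → ℝ) × (ℕ → ℝ)) : ℝ≥0∞ :=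
  ∑' k : ℕ, if ∑ i ∈ Finset.range (k + 1), p.1 i ≤ t then ENNReal.ofReal (p.2 k) else 0

lemma measurable_aggregateOfSeq (t : ℝ≥0) : Measurable (aggregateOfSeq t) := by
  refine Measurable.tsum fun k => Measurable.ite ?_ (by fun_prop) measurable_const
  exact measurableSet_le (by fun_prop) measurable_const

lemma aggregate_eq_aggregateOfSeq (hN : IsCountingProcess N) (X : ℕ → Ω → ℝ) (t : ℝ≥0) (ω : Ω) :
    aggregate N X t ω
      = aggregateOfSeq t (fun n => interarrival N n ω, fun n => X n ω) := by
  refine tsum_congr fun k => ?_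
  -- Claims are numbered from `0`, so claim `k` is counted by time `t` exactly when arrival `k + 1`
  -- has taken place.
  have : (k : ℕ∞) < N t ω ↔ ∑ i ∈ Finset.range (k + 1), interarrival N i ω ≤ t := by
    rw [hN.sum_interarrival, NNReal.coe_le_coe, hN.arrival_le_iff]
    push_cast
    exact (Order.add_one_le_iff_of_not_isMax (by simp)).symm
  simp only [this]

lemma IsCountingProcess.measurable_arrival (hN : IsCountingProcess N) (n : ℕ) :
    Measurable (arrival N n) := by
  refine measurable_of_Iic fun t => ?_
  have : arrival N n ⁻¹' Set.Iic t = N t ⁻¹' Set.Ici (n : ℕ∞) := by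
    ext ω; exact hN.arrival_le_iff n ω t
  rw [this]
  exact hN.measurable t (MeasurableSet.of_discrete)

lemma IsCountingProcess.measurable_interarrival (hN : IsCountingProcess N) :
    Measurable fun ω n => interarrival N n ω :=
  measurable_pi_lambda _ fun n =>
    (hN.measurable_arrival (n + 1)).coe_nnreal_real.sub (hN.measurable_arrival n).coe_nnreal_real

lemma IsClaimSizeProcess.measurable_seq (hX : IsClaimSizeProcess X) :
    Measurable fun ω n => X n ω :=
  measurable_pi_lambda _ hX.measurable

end Paths

/-! ### Recovering claims and interarrival times from the aggregate process. -/

section Filtration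

variable {Ω 𝓓 : Type*} [MeasurableSpace 𝓓]

lemma measurable_filtInf_param (S : ℝ≥0 → Ω → ℝ≥0∞) (Θ : Ω → 𝓓) : Measurable[filtInf S Θ] Θ :=
  measurable_iff_comap_le.2 le_sup_right

lemma measurable_filtInf_apply (S : ℝ≥0 → Ω → ℝ≥0∞) (Θ : Ω → 𝓓) (t : ℝ≥0) :
    Measurable[filtInf S Θ] (S t) :=
  measurable_iff_comap_le.2 <| le_sup_of_le_left <|
    (le_iSup (fun s : Set.Iic t => sigmaOf (S s)) ⟨t, Set.mem_Iic.2 le_rfl⟩).trans (le_iSup (filtS S) t)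

lemma filtInf_le {m : MeasurableSpace Ω} {S : ℝ≥0 → Ω → ℝ≥0∞} {Θ : Ω → 𝓓}
    (hS : ∀ t, Measurable (S t)) (hΘ : Measurable Θ) : filtInf S Θ ≤ m :=
  sup_le (iSup_le fun _ => iSup_le fun s => (hS s).comap_le) hΘ.comap_le

variable {N : ℝ≥0 → Ω → ℕ∞} {X : ℕ → Ω → ℝ}

/-- Here `m` is any σ-algebra that makes the aggregate process measurable, later 𝓕_∞; `m₀` only
carries the counting process hypothesis. -/
lemma measurable_claimSum_of_aggregate {m₀ : MeasurableSpace Ω}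
    (hN : IsCountingProcess N) {m : MeasurableSpace Ω} (hX : ∀ n ω, 0 < X n ω)
    (hS : ∀ t, Measurable[m] (aggregate N X t)) (n : ℕ) : Measurable[m] (claimSum X n) := by
  induction n with
  | zero => exact measurable_const (a := (0 : ℝ≥0∞))
  | succ n ih =>
    rw [funext (claimSum_succ_eq_iInf hN hX n)]
    exact Measurable.iInf fun i =>
      Measurable.ite (measurableSet_lt ih (hS _)) (hS _) measurable_const

lemma measurable_claims_of_aggregate {m₀ : MeasurableSpace Ω}
    (hN : IsCountingProcess N) {m : MeasurableSpace Ω} (hX : ∀ n ω, 0 < X n ω)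
    (hS : ∀ t, Measurable[m] (aggregate N X t)) : Measurable[m] fun ω n => X n ω := by
  refine measurable_pi_lambda _ fun n => ?_
  have h : X n = fun ω => (claimSum X (n + 1) ω - claimSum X n ω).toReal := by
    ext ω
    rw [claimSum_succ, ENNReal.add_sub_cancel_left (claimSum_ne_top X n ω),
      ENNReal.toReal_ofReal (hX n ω).le]
  rw [h]
  exact ((measurable_claimSum_of_aggregate hN hX hS (n + 1)).sub
    (measurable_claimSum_of_aggregate hN hX hS n)).ennreal_toReal

lemma measurable_interarrival_of_aggregate {m₀ : MeasurableSpace Ω}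
    (hN : IsCountingProcess N) {m : MeasurableSpace Ω} (hX : ∀ n ω, 0 < X n ω)
    (hS : ∀ t, Measurable[m] (aggregate N X t)) :
    Measurable[m] fun ω n => interarrival N n ω := by
  have harr : ∀ n, Measurable (arrival N n) := by
    intro n
    refine measurable_of_Iic fun t => ?_
    rcases n with _ | n
    · rw [show arrival N 0 = fun _ => 0 from funext hN.arrival_zero]
      exact measurable_const measurableSet_Iic
    -- Arrival `n + 1` has occurred by `t` exactly when the aggregate exceeds the sum of the first
    -- `n` claims.
    · have h : arrival N (n + 1) ⁻¹' Set.Iic t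
          = {ω | claimSum X n ω < aggregate N X t ω} := by
        ext ω
        exact (hN.arrival_le_iff _ ω t).trans (claimSum_lt_aggregate_iff hN hX n t ω).symm
      rw [h]
      exact measurableSet_lt (measurable_claimSum_of_aggregate hN hX hS n) (hS t)
  exact measurable_pi_lambda _ fun n =>
    (harr (n + 1)).coe_nnreal_real.sub (harr n).coe_nnreal_real

variable [MeasurableSpace Ω]

/-- The events of `𝓕_∞` are those expressed by interarrival times, claim sizes and parameter. -/
lemma filtInf_le_comap (hN : IsCountingProcess N) (X : ℕ → Ω → ℝ) (Θ : Ω → 𝓓) :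
    filtInf (aggregate N X) Θ
      ≤ sigmaOf fun ω => ((fun n => interarrival N n ω, fun n => X n ω), Θ ω) := by
  set f : Ω → ((ℕ → ℝ) × (ℕ → ℝ)) × 𝓓 :=
    fun ω => ((fun n => interarrival N n ω, fun n => X n ω), Θ ω)
  have hm : Measurable[sigmaOf f] f := comap_measurable f
  refine filtInf_le (fun t => ?_) (measurable_snd.comp hm)
  rw [funext (aggregate_eq_aggregateOfSeq hN X t)]
  exact (measurable_aggregateOfSeq t).comp (measurable_fst.comp hm)

lemma filtInf_aggregate_le (hN : IsCountingProcess N) (hX : IsClaimSizeProcess X) {Θ : Ω → 𝓓}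
    (hΘ : Measurable Θ) : filtInf (aggregate N X) Θ ≤ ‹MeasurableSpace Ω› :=
  (filtInf_le_comap hN X Θ).trans
    ((hN.measurable_interarrival.prodMk hX.measurable_seq).prodMk hΘ).comap_le

end Filtration

/-- A countably generated `σ`-algebra is generated by a countable `π`-system. -/
lemma exists_countable_isPiSystem_generateFrom (α : Type*) [m : MeasurableSpace α]
    [MeasurableSpace.CountablyGenerated α] :
    ∃ C : Set (Set α), C.Countable ∧ IsPiSystem C ∧ Set.univ ∈ C ∧
      m = MeasurableSpace.generateFrom C := by
  set b := MeasurableSpace.countableGeneratingSet α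
  have hb : b.Countable := MeasurableSpace.countable_countableGeneratingSet
  refine ⟨(fun f => ⋂₀ f) '' {f | f.Finite ∧ f ⊆ b},
    (Set.countable_ofPred_finite_subset hb).image _, ?_, ⟨∅, by simp⟩, le_antisymm ?_ ?_⟩
  · rintro _ ⟨f, ⟨hf, hfb⟩, rfl⟩ _ ⟨g, ⟨hg, hgb⟩, rfl⟩ -
    exact ⟨f ∪ g, ⟨hf.union hg, Set.union_subset hfb hgb⟩, Set.sInter_union f g⟩
  · rw [← MeasurableSpace.generateFrom_countableGeneratingSet (α := α)]
    refine MeasurableSpace.generateFrom_mono fun s hs => ⟨{s}, ⟨Set.finite_singleton s, ?_⟩, ?_⟩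
    · simpa using hs
    · simp
  · refine MeasurableSpace.generateFrom_le ?_
    rintro _ ⟨f, ⟨hf, hfb⟩, rfl⟩
    exact MeasurableSet.sInter hf.countable fun t ht =>
      MeasurableSpace.measurableSet_countableGeneratingSet (hfb ht)

/-! ### Consistent disintegrations and what they inherit from the measure. -/

section RCP

variable {Ω 𝓓 : Type*} [MeasurableSpace Ω] [MeasurableSpace 𝓓] {P : Measure Ω}
  {Θ : Ω → 𝓓} {κ : 𝓓 → Measure Ω}

/-- Consistency for `B` and `Bᶜ` makes `κ θ` ignore or annihilate `Θ ⁻¹' B` according to `θ`, which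
localizes the disintegration formula. -/
lemma IsConsistentRCP.setLIntegral_eq (hκ : IsConsistentRCP P Θ κ) (hΘ : Measurable Θ)
    {A : Set Ω} (hA : MeasurableSet A) {B : Set 𝓓} (hB : MeasurableSet B) :
    ∫⁻ θ in B, κ θ A ∂(P.map Θ) = P (A ∩ Θ ⁻¹' B) := by
  rw [← hκ.disintegrates _ (hA.inter (hΘ hB)), ← lintegral_indicator hB]
  refine lintegral_congr_ae ?_
  filter_upwards [hκ.consistent B hB, hκ.consistent Bᶜ hB.compl] with θ h1 h2
  have := hκ.isProb θ
  by_cases hθ : θ ∈ B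
  · rw [Set.indicator_of_mem hθ, measure_inter_conull]
    exact (prob_compl_eq_zero_iff (hΘ hB)).2 (h1 hθ)
  · rw [Set.indicator_of_notMem hθ]
    refine (measure_mono_null (fun ω hω => hω.2) ?_).symm
    rw [← compl_compl (Θ ⁻¹' B)]
    exact (prob_compl_eq_zero_iff (hΘ hB).compl).2 (h2 hθ)

lemma IsConsistentRCP.measure_eq_zero_iff (hκ : IsConsistentRCP P Θ κ)
    {A : Set Ω} (hA : MeasurableSet A) :
    P A = 0 ↔ ∀ᵐ θ ∂(P.map Θ), κ θ A = 0 := by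
  rw [← hκ.disintegrates A hA, lintegral_eq_zero_iff (hκ.measurable A hA)]
  rfl

lemma IsConsistentRCP.ae_of_ae_ae (hκ : IsConsistentRCP P Θ κ) {p : Ω → Prop}
    (hp : MeasurableSet {ω | p ω}) (h : ∀ᵐ θ ∂(P.map Θ), ∀ᵐ ω ∂(κ θ), p ω) : ∀ᵐ ω ∂P, p ω :=
  (hκ.measure_eq_zero_iff hp.compl).2 h

/-- The null set in the consistency condition depends on `B`. A countable generating family yields a
single null set, and it still separates points. -/
lemma IsConsistentRCP.ae_param_eq [MeasurableSpace.CountablyGenerated 𝓓]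
    [MeasurableSpace.SeparatesPoints 𝓓] (hκ : IsConsistentRCP P Θ κ) (hΘ : Measurable Θ) :
    ∀ᵐ θ ∂(P.map Θ), ∀ᵐ ω ∂(κ θ), Θ ω = θ := by
  obtain ⟨C, hC, -, -, hgen⟩ := exists_countable_isPiSystem_generateFrom 𝓓
  have hCm : ∀ s ∈ C, MeasurableSet s := fun s hs => by
    rw [hgen]; exact MeasurableSpace.measurableSet_generateFrom hs
  have h : ∀ᵐ θ ∂(P.map Θ), ∀ s ∈ C,
      (θ ∈ s → κ θ (Θ ⁻¹' s) = 1) ∧ (θ ∈ sᶜ → κ θ (Θ ⁻¹' sᶜ) = 1) :=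
    (ae_ball_iff hC).2 fun s hs =>
      (hκ.consistent s (hCm s hs)).and (hκ.consistent sᶜ (hCm s hs).compl)
  filter_upwards [h] with θ hθ
  have := hκ.isProb θ
  have h2 : ∀ᵐ ω ∂(κ θ), ∀ s ∈ C, (Θ ω ∈ s ↔ θ ∈ s) := by
    refine (ae_ball_iff hC).2 fun s hs => ?_
    by_cases hmem : θ ∈ s
    · have h1 := (hθ s hs).1 hmem
      filter_upwards [(mem_ae_iff_prob_eq_one (hΘ (hCm s hs))).2 h1] with ω hω
      exact iff_of_true hω hmem
    · have h1 := (hθ s hs).2 hmem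
      filter_upwards [(mem_ae_iff_prob_eq_one (hΘ (hCm s hs).compl)).2 h1] with ω hω
      exact iff_of_false hω hmem
  filter_upwards [h2] with ω hω
  have : @MeasurableSpace.SeparatesPoints 𝓓 (MeasurableSpace.generateFrom C) := by
    rw [← hgen]; infer_instance
  exact MeasurableSpace.separating_of_generateFrom C _ _ hω

/-- The bridge from conditional expectations, in which the model is phrased, to statements about the
individual measures `κ θ`. -/
lemma IsConsistentRCP.condProb_ae_eq [IsProbabilityMeasure P] (hκ : IsConsistentRCP P Θ κ)
    (hΘ : Measurable Θ) {A : Set Ω} (hA : MeasurableSet A) :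
    condProb P Θ A =ᵐ[P] fun ω => (κ (Θ ω)).real A := by
  have hmeas : Measurable fun θ => (κ θ).real A := (hκ.measurable A hA).ennreal_toReal
  have hint : Integrable (fun ω => (κ (Θ ω)).real A) P := by
    refine Integrable.of_bound (hmeas.comp hΘ).aestronglyMeasurable 1 (ae_of_all _ fun ω => ?_)
    have := hκ.isProb (Θ ω)
    simp [abs_of_nonneg measureReal_nonneg]
  refine (ae_eq_condExp_of_forall_setIntegral_eq hΘ.comap_le
    ((integrable_const 1).indicator hA) (fun _ _ _ => hint.integrableOn) ?_
    (hmeas.comp (comap_measurable Θ)).stronglyMeasurable.aestronglyMeasurable).symm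
  rintro _ ⟨B, hB, rfl⟩ -
  have h1 : ∫ ω in Θ ⁻¹' B, (κ (Θ ω)).real A ∂P = ∫ θ in B, (κ θ).real A ∂(P.map Θ) :=
    (setIntegral_map hB hmeas.aestronglyMeasurable hΘ.aemeasurable).symm
  have h2 : ∫ θ in B, (κ θ).real A ∂(P.map Θ) = P.real (A ∩ Θ ⁻¹' B) := by
    simp only [Measure.real]
    rw [integral_toReal (hκ.measurable A hA).aemeasurable, hκ.setLIntegral_eq hΘ hA hB]
    refine ae_of_all _ fun θ => ?_
    have := hκ.isProb θ
    exact measure_lt_top _ _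
  rw [h1, h2, setIntegral_indicator hA, setIntegral_const, smul_eq_mul, mul_one, Set.inter_comm]

lemma ae_map_eq_of_ae_comp [IsProbabilityMeasure P]
    (hΘ : Measurable Θ) {f g : 𝓓 → ℝ} (hf : Measurable f) (hg : Measurable g)
    (h : ∀ᵐ ω ∂P, f (Θ ω) = g (Θ ω)) : ∀ᵐ θ ∂(P.map Θ), f θ = g θ :=
  (ae_map_iff hΘ.aemeasurable (measurableSet_eq_fun hf hg)).2 h

lemma IsConsistentRCP.measurable_real (hκ : IsConsistentRCP P Θ κ) {A : Set Ω}
    (hA : MeasurableSet A) : Measurable fun θ => (κ θ).real A :=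
  (hκ.measurable A hA).ennreal_toReal

/-- A process independent of the parameter has the same law under almost every `κ θ`. -/
lemma IsConsistentRCP.ae_map_eq_of_indepFun {E : Type*} [MeasurableSpace E]
    [MeasurableSpace.CountablyGenerated E] [IsProbabilityMeasure P] (hκ : IsConsistentRCP P Θ κ)
    (hΘ : Measurable Θ) {U : Ω → E} (hU : Measurable U) (hind : IndepFun Θ U P) :
    ∀ᵐ θ ∂(P.map Θ), (κ θ).map U = P.map U := by
  obtain ⟨C, hC, hpi, -, hgen⟩ := exists_countable_isPiSystem_generateFrom E
  have hCm : ∀ s ∈ C, MeasurableSet s := fun s hs => by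
    rw [hgen]; exact MeasurableSpace.measurableSet_generateFrom hs
  have : IsProbabilityMeasure (P.map Θ) := Measure.isProbabilityMeasure_map hΘ.aemeasurable
  have : IsProbabilityMeasure (P.map U) := Measure.isProbabilityMeasure_map hU.aemeasurable
  -- Countability of the π-system permits one exceptional set of parameters for all its events.
  have h : ∀ᵐ θ ∂(P.map Θ), ∀ s ∈ C, κ θ (U ⁻¹' s) = P (U ⁻¹' s) := by
    refine (ae_ball_iff hC).2 fun s hs => ?_
    refine ae_eq_of_forall_setLIntegral_eq_of_sigmaFinite
      (hκ.measurable _ (hU (hCm s hs))) measurable_const fun B hB _ => ?_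
    rw [hκ.setLIntegral_eq hΘ (hU (hCm s hs)) hB, setLIntegral_const, Set.inter_comm,
      hind.measure_inter_preimage_eq_mul B s hB (hCm s hs), Measure.map_apply hΘ hB, mul_comm]
  filter_upwards [h] with θ hθ
  have := hκ.isProb θ
  have : IsProbabilityMeasure ((κ θ).map U) := Measure.isProbabilityMeasure_map hU.aemeasurable
  refine ext_of_generate_finite C hgen hpi (fun s hs => ?_) (by simp)
  rw [Measure.map_apply hU (hCm s hs), Measure.map_apply hU (hCm s hs), hθ s hs]

/-- Processes that are conditionally independent given the parameter are independent under
almost every `κ θ`. -/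
lemma IsConsistentRCP.ae_map_prod_eq_of_condIndepPair [IsProbabilityMeasure P]
    (hκ : IsConsistentRCP P Θ κ) (hΘ : Measurable Θ) {V U : ℕ → Ω → ℝ}
    (hV : Measurable fun ω n => V n ω) (hU : Measurable fun ω n => U n ω)
    (hVU : CondIndepPair P Θ V U) :
    ∀ᵐ θ ∂(P.map Θ), (κ θ).map (fun ω => ((fun n => V n ω), (fun n => U n ω)))
      = ((κ θ).map fun ω n => V n ω).prod ((κ θ).map fun ω n => U n ω) := by
  obtain ⟨C, hC, hpi, huniv, hgen⟩ := exists_countable_isPiSystem_generateFrom (ℕ → ℝ)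
  have hCm : ∀ s ∈ C, MeasurableSet s := fun s hs => by
    rw [hgen]; exact MeasurableSpace.measurableSet_generateFrom hs
  have h : ∀ᵐ θ ∂(P.map Θ), ∀ s ∈ C, ∀ t ∈ C,
      (κ θ).real ((fun ω n => V n ω) ⁻¹' s ∩ (fun ω n => U n ω) ⁻¹' t)
        = (κ θ).real ((fun ω n => V n ω) ⁻¹' s) * (κ θ).real ((fun ω n => U n ω) ⁻¹' t) := by
    refine (ae_ball_iff hC).2 fun s hs => (ae_ball_iff hC).2 fun t ht => ?_
    have hs' := hV (hCm s hs)
    have ht' := hU (hCm t ht)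
    refine ae_map_eq_of_ae_comp hΘ (hκ.measurable_real (hs'.inter ht'))
      ((hκ.measurable_real hs').mul (hκ.measurable_real ht')) ?_
    filter_upwards [hVU s t (hCm s hs) (hCm t ht), hκ.condProb_ae_eq hΘ (hs'.inter ht'),
      hκ.condProb_ae_eq hΘ hs', hκ.condProb_ae_eq hΘ ht'] with ω h0 h1 h2 h3
    rw [← h1, ← h2, ← h3]
    exact h0
  filter_upwards [h] with θ hθ
  have := hκ.isProb θ
  have : IsProbabilityMeasure ((κ θ).map fun ω n => V n ω) :=
    Measure.isProbabilityMeasure_map hV.aemeasurable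
  have : IsProbabilityMeasure ((κ θ).map fun ω n => U n ω) :=
    Measure.isProbabilityMeasure_map hU.aemeasurable
  have hspan : ∀ μ : Measure (ℕ → ℝ), IsProbabilityMeasure μ → μ.FiniteSpanningSetsIn C :=
    fun μ _ => ⟨fun _ => Set.univ, fun _ => huniv, fun _ => measure_lt_top _ _, Set.iUnion_const _⟩
  symm
  refine Measure.prod_eq_generateFrom hgen.symm hgen.symm hpi hpi (hspan _ inferInstance)
    (hspan _ inferInstance) fun s hs t ht => ?_
  rw [Measure.map_apply (hV.prodMk hU) ((hCm s hs).prod (hCm t ht)),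
    Measure.map_apply hV (hCm s hs), Measure.map_apply hU (hCm t ht),
    ← ENNReal.toReal_eq_toReal_iff' (measure_ne_top _ _) (by finiteness), ENNReal.toReal_mul]
  exact hθ s hs t ht

end RCP

/-! ### Product laws of interarrival times and claims. -/

/-- A sequence whose finite-dimensional distribution functions factor at rational points has as
law the infinite product. -/
lemma map_eq_infinitePi_of_rat {Ω : Type*} [MeasurableSpace Ω] {μ : Measure Ω}
    [IsProbabilityMeasure μ] {ν : Measure ℝ} [IsProbabilityMeasure ν] {V : ℕ → Ω → ℝ}
    (hV : Measurable fun ω n => V n ω)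
    (h : ∀ (n : ℕ) (v : Fin n → ℚ),
      μ (⋂ k : Fin n, {ω | V k ω ≤ v k}) = ∏ k : Fin n, ν (Set.Iic (v k : ℝ))) :
    μ.map (fun ω n => V n ω) = Measure.infinitePi fun _ => ν := by
  have hVn : ∀ n, Measurable (V n) := fun n => measurable_pi_iff.1 hV n
  have hfin : ∀ n : ℕ, Measure.pi (fun _ : Fin n => ν) = μ.map fun ω (k : Fin n) => V k ω := by
    intro n
    have hm : Measurable fun ω (k : Fin n) => V k ω := measurable_pi_lambda _ fun k => hVn k
    refine Measure.pi_eq_generateFrom (C := fun _ => ⋃ a : ℚ, {Set.Iic (a : ℝ)})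
      (fun _ => Real.borel_eq_generateFrom_Iic_rat.symm.trans (BorelSpace.measurable_eq).symm)
      (fun _ => Real.isPiSystem_Iic_rat)
      (fun _ => ⟨fun m => Set.Iic (m : ℝ), fun m => by simpa using ⟨(m : ℚ), by simp⟩,
        fun _ => measure_lt_top _ _, ?_⟩) fun s hs => ?_
    · refine Set.eq_univ_of_forall fun x => Set.mem_iUnion.2 ?_
      exact exists_nat_ge x
    · have hs' : ∀ k, ∃ a : ℚ, Set.Iic (a : ℝ) = s k := fun k => by simpa [eq_comm] using hs k
      choose v hv using hs'
      obtain rfl : (fun k => Set.Iic (v k : ℝ)) = s := funext hv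
      rw [Measure.map_apply hm (MeasurableSet.univ_pi fun _ => measurableSet_Iic), ← h n v]
      congr 1
      ext ω
      simp [Pi.le_def]
  refine Measure.eq_infinitePi _ fun s t ht => ?_
  obtain ⟨n, hn⟩ : ∃ n, s ⊆ Finset.range n := s.exists_nat_subset_range
  -- Padding with `Set.univ` turns a cylinder over `s` into a box in the first `n` coordinates,
  -- without changing its mass.
  set t' : ℕ → Set ℝ := fun i => if i ∈ s then t i else Set.univ with ht'
  have htm : ∀ i, MeasurableSet (t' i) := fun i => by
    rw [ht']; dsimp only; split_ifs; exacts [ht i, MeasurableSet.univ]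
  have hset : (fun ω n => V n ω) ⁻¹' (Set.pi s t)
      = (fun ω (k : Fin n) => V k ω) ⁻¹' (Set.pi Set.univ fun k : Fin n => t' k) := by
    ext ω
    simp only [Set.mem_preimage, Set.mem_pi, Set.mem_univ, true_implies, Finset.mem_coe]
    refine ⟨fun hω k => ?_, fun hω i hi => ?_⟩
    · by_cases hk : (k : ℕ) ∈ s
      · simpa [ht', hk] using hω k hk
      · simp [ht', hk]
    · simpa [ht', hi] using hω ⟨i, Finset.mem_range.1 (hn hi)⟩
  rw [Measure.map_apply hV (MeasurableSet.pi s.countable_toSet fun i _ => ht i), hset,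
    ← Measure.map_apply (f := fun ω (k : Fin n) => V k ω) (measurable_pi_lambda _ fun k => hVn k)
      (MeasurableSet.univ_pi fun k => htm k), ← hfin n, Measure.pi_pi,
    Fin.prod_univ_eq_prod_range (fun i => ν (t' i)) n, ← Finset.prod_subset hn]
  · exact Finset.prod_congr rfl fun i hi => by simp [ht', hi]
  · intro i _ hi
    simp [ht', hi]

section MRP

variable {Ω 𝓓 : Type*} [MeasurableSpace Ω] [MeasurableSpace 𝓓] {P : Measure Ω}
  {Θ : Ω → 𝓓} {κ : 𝓓 → Measure Ω} {N : ℝ≥0 → Ω → ℕ∞} {X : ℕ → Ω → ℝ}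

/-- Under almost every `κ θ` the interarrival times of a mixed renewal process are i.i.d. -/
lemma IsMRP.ae_map_interarrival_eq [IsProbabilityMeasure P] {K : Kernel 𝓓 ℝ} [IsMarkovKernel K]
    (hN : IsMRP P N Θ K) (hκ : IsConsistentRCP P Θ κ) (hΘ : Measurable Θ) :
    ∀ᵐ θ ∂(P.map Θ), (κ θ).map (fun ω n => interarrival N n ω)
      = Measure.infinitePi fun _ => K θ := by
  have hW := hN.counting.measurable_interarrival
  have hWn : ∀ n (a : ℝ), MeasurableSet {ω | interarrival N n ω ≤ a} := fun n a =>
    measurable_pi_iff.1 hW n measurableSet_Iic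
  -- Rational thresholds keep the family of conditions countable, so a single null set serves them
  -- all.
  have h : ∀ᵐ θ ∂(P.map Θ), ∀ (n : ℕ) (v : Fin n → ℚ),
      (κ θ).real (⋂ k : Fin n, {ω | interarrival N k ω ≤ v k})
        = ∏ k : Fin n, (K θ).real (Set.Iic (v k : ℝ)) := by
    refine ae_all_iff.2 fun n => ae_all_iff.2 fun v => ?_
    have hI : MeasurableSet (⋂ k : Fin n, {ω | interarrival N k ω ≤ v k}) :=
      MeasurableSet.iInter fun k => hWn k (v k)
    refine ae_map_eq_of_ae_comp hΘ (hκ.measurable_real hI)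
      (Finset.measurable_prod _ fun k _ =>
        (K.measurable_coe measurableSet_Iic).ennreal_toReal) ?_
    have hd := ae_all_iff.2 fun k : Fin n => hN.condDistrib k (Set.Iic (v k : ℝ)) measurableSet_Iic
    filter_upwards [hN.condIndep n (fun k => (v k : ℝ)), hκ.condProb_ae_eq hΘ hI, hd]
      with ω h0 h1 h2
    rw [← h1, h0]
    exact Finset.prod_congr rfl fun k _ => h2 k
  filter_upwards [h] with θ hθ
  have := hκ.isProb θ
  refine map_eq_infinitePi_of_rat hW fun n v => ?_
  rw [← ENNReal.toReal_eq_toReal_iff' (measure_ne_top _ _) 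
      (ENNReal.prod_ne_top fun _ _ => measure_ne_top _ _), ENNReal.toReal_prod]
  exact hθ n v

lemma IsRiskProcess.map_claims_eq [IsProbabilityMeasure P] (hR : IsRiskProcess P N X) :
    P.map (fun ω n => X n ω) = Measure.infinitePi fun _ => P.map (X 0) := by
  rw [hR.indep.map_fun_eq_infinitePi_map hR.claims.measurable]
  simp only [fun n => (hR.identDistrib n).map_eq]

end MRP

/-! ### Empirical laws and the strong law of large numbers. -/

/-- The empirical distribution functions of the sequence `w` converge, at every rational point, to
the distribution function of `ν`. -/
def HasEmpiricalLaw (w : ℕ → ℝ) (ν : Measure ℝ) : Prop :=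
  ∀ q : ℚ, Tendsto
    (fun n : ℕ => (∑ i ∈ Finset.range n, (Set.Iic (q : ℝ)).indicator (fun _ => (1 : ℝ)) (w i)) / n)
    atTop (𝓝 (ν.real (Set.Iic (q : ℝ))))

/-- Limits are unique and rational half-lines form a generating π-system. Hence distinct laws give
disjoint events, the source of singularity. -/
lemma HasEmpiricalLaw.unique {w : ℕ → ℝ} {μ ν : Measure ℝ} [IsProbabilityMeasure μ]
    [IsProbabilityMeasure ν] (hμ : HasEmpiricalLaw w μ) (hν : HasEmpiricalLaw w ν) : μ = ν := by
  refine ext_of_generate_finite (⋃ a : ℚ, {Set.Iic (a : ℝ)})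
    ((BorelSpace.measurable_eq).trans Real.borel_eq_generateFrom_Iic_rat)
    Real.isPiSystem_Iic_rat (fun s hs => ?_) (by simp)
  obtain ⟨q, rfl⟩ : ∃ q : ℚ, Set.Iic (q : ℝ) = s := by simpa [eq_comm] using hs
  exact (ENNReal.toReal_eq_toReal_iff' (measure_ne_top _ _) (measure_ne_top _ _)).1
    (tendsto_nhds_unique (hμ q) (hν q))

/-- The Glivenko–Cantelli theorem at rational points. -/
lemma ae_hasEmpiricalLaw (ν : Measure ℝ) [IsProbabilityMeasure ν] :
    ∀ᵐ w ∂(Measure.infinitePi fun _ : ℕ => ν), HasEmpiricalLaw w ν := by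
  refine ae_all_iff.2 fun q => ?_
  set f : ℝ → ℝ := (Set.Iic (q : ℝ)).indicator fun _ => (1 : ℝ)
  have hf : Measurable f := measurable_const.indicator measurableSet_Iic
  have hind : iIndepFun (fun (i : ℕ) (w : ℕ → ℝ) => f (w i)) (Measure.infinitePi fun _ => ν) :=
    iIndepFun_infinitePi fun _ => hf
  have hmap : ∀ i : ℕ, (Measure.infinitePi fun _ : ℕ => ν).map (fun w => f (w i)) = ν.map f := by
    intro i
    conv_rhs => rw [← Measure.infinitePi_map_eval (fun _ : ℕ => ν) i]
    rw [Measure.map_map hf (measurable_pi_apply i)]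
    rfl
  have hm : ∀ i : ℕ, Measurable fun w : ℕ → ℝ => f (w i) := fun i =>
    hf.comp (measurable_pi_apply i)
  have hint : ∫ w, f (w 0) ∂(Measure.infinitePi fun _ : ℕ => ν) = ν.real (Set.Iic (q : ℝ)) := by
    rw [← integral_indicator_one measurableSet_Iic]
    conv_rhs => rw [← Measure.infinitePi_map_eval (fun _ : ℕ => ν) 0]
    exact (integral_map (measurable_pi_apply 0).aemeasurable hf.aestronglyMeasurable).symm
  have h := strong_law_ae_real (μ := Measure.infinitePi fun _ : ℕ => ν)
    (fun (i : ℕ) (w : ℕ → ℝ) => f (w i)) ?_ (fun i j hij => hind.indepFun hij)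
    fun i => ⟨(hm i).aemeasurable, (hm 0).aemeasurable, (hmap i).trans (hmap 0).symm⟩
  · rwa [hint] at h
  · refine Integrable.of_bound (hm 0).aestronglyMeasurable 1 (ae_of_all _ fun w => ?_)
    exact (norm_indicator_le_norm_self _ _).trans (by simp)

/-- The target law may vary with the point, as needed for the random law `K (Θ ω)`. -/
lemma measurableSet_hasEmpiricalLaw {α : Type*} [MeasurableSpace α] {w : α → ℕ → ℝ}
    {ν : α → Measure ℝ} (hw : Measurable w)
    (hν : ∀ s, MeasurableSet s → Measurable fun a => (ν a).real s) :
    MeasurableSet {a | HasEmpiricalLaw (w a) (ν a)} := by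
  simp only [HasEmpiricalLaw, Set.ofPred_forall]
  refine MeasurableSet.iInter fun q => ?_
  have h : ∀ n : ℕ, Measurable fun a => (∑ i ∈ Finset.range n,
      (Set.Iic (q : ℝ)).indicator (fun _ => (1 : ℝ)) (w a i)) / n
      - (ν a).real (Set.Iic (q : ℝ)) := fun n =>
    ((Finset.measurable_sum _ fun i _ => (measurable_const.indicator measurableSet_Iic).comp
      ((measurable_pi_apply i).comp hw)).div_const _).sub (hν _ measurableSet_Iic)
  -- Subtracting the point-dependent limit reduces to convergence to the constant `0`.
  convert measurableSet_tendsto (l := atTop) (𝓝 (0 : ℝ)) h using 3 with a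
  exact tendsto_sub_nhds_zero_iff.symm

/-! ### Equivalence, singularity and the dichotomy. -/

/-- If the disintegrations coincide on a sub-`σ`-algebra, the measures are equivalent there. -/
lemma equivOn_of_ae_eqOn {Ω 𝓓 : Type*} {𝓖 mΩ : MeasurableSpace Ω} [MeasurableSpace 𝓓]
    {P Q : Measure Ω} {Θ : Ω → 𝓓} {κP κQ : 𝓓 → Measure Ω} (h𝓖 : 𝓖 ≤ mΩ)
    (hκP : IsConsistentRCP P Θ κP) (hκQ : IsConsistentRCP Q Θ κQ)
    (hPQ : P.map Θ ≪ Q.map Θ) (hQP : Q.map Θ ≪ P.map Θ)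
    (h : ∀ᵐ θ ∂(P.map Θ), EqOn (κP θ) (κQ θ) 𝓖) : EquivOn P Q 𝓖 := by
  intro A hA
  rw [hκP.measure_eq_zero_iff (h𝓖 A hA), hκQ.measure_eq_zero_iff (h𝓖 A hA)]
  refine ⟨fun h0 => hQP.ae_le ?_, fun h0 => ?_⟩
  · filter_upwards [h, h0] with θ h1 h2 using (h1 A hA).symm.trans h2
  · filter_upwards [h, hPQ.ae_le h0] with θ h1 h2 using (h1 A hA).trans h2

lemma singularOn_of_ae {Ω : Type*} {𝓖 mΩ : MeasurableSpace Ω} {P Q : Measure Ω}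
    [IsProbabilityMeasure Q] {p : Ω → Prop}
    (h𝓖 : 𝓖 ≤ mΩ) (hp : MeasurableSet[𝓖] {ω | p ω})
    (hP : ∀ᵐ ω ∂P, p ω) (hQ : ∀ᵐ ω ∂Q, ¬ p ω) : SingularOn P Q 𝓖 :=
  ⟨{ω | p ω}ᶜ, hp.compl, hP, (mem_ae_iff_prob_eq_one (h𝓖 _ hp.compl)).1
    (show ∀ᵐ ω ∂Q, ω ∈ {ω | p ω}ᶜ from hQ)⟩

section Main

variable {Ω 𝓓 : Type*} [MeasurableSpace Ω] [MeasurableSpace 𝓓] {P Q : Measure Ω}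
  {Θ : Ω → 𝓓} {κP κQ : 𝓓 → Measure Ω} {N : ℝ≥0 → Ω → ℕ∞} {X : ℕ → Ω → ℝ}

/-- Time `0` is enough, since σ(`Θ`) is contained in every 𝓕_t. -/
lemma MemClass.map_absolutelyContinuous {K : Kernel 𝓓 ℝ} (hQ : MemClass P N X Θ K Q)
    (hΘ : Measurable Θ) : P.map Θ ≪ Q.map Θ ∧ Q.map Θ ≪ P.map Θ := by
  have h : ∀ B, MeasurableSet B → (P (Θ ⁻¹' B) = 0 ↔ Q (Θ ⁻¹' B) = 0) := fun B hB =>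
    hQ.progressivelyEquiv 0 _ (le_sup_right (a := filtS (aggregate N X) 0) _ ⟨B, hB, rfl⟩)
  constructor <;> refine Measure.AbsolutelyContinuous.mk fun B hB h0 => ?_
  · rw [Measure.map_apply hΘ hB] at h0 ⊢
    exact (h B hB).2 h0
  · rw [Measure.map_apply hΘ hB] at h0 ⊢
    exact (h B hB).1 h0

lemma eqOn_filtInf_of_map_eq {μ ν : Measure Ω} (hN : IsCountingProcess N)
    (hX : IsClaimSizeProcess X) (hΘ : Measurable Θ)
    (h : μ.map (fun ω => ((fun n => interarrival N n ω, fun n => X n ω), Θ ω))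
      = ν.map (fun ω => ((fun n => interarrival N n ω, fun n => X n ω), Θ ω))) :
    EqOn μ ν (filtInf (aggregate N X) Θ) := by
  intro A hA
  have hm := (hN.measurable_interarrival.prodMk hX.measurable_seq).prodMk hΘ
  obtain ⟨B, hB, rfl⟩ := filtInf_le_comap hN X Θ A hA
  rw [← Measure.map_apply hm hB, ← Measure.map_apply hm hB]
  exact congrArg (fun m => m B) h

lemma IsRiskProcess.ae_hasEmpiricalLaw_claims [IsProbabilityMeasure P]
    (hR : IsRiskProcess P N X) :
    ∀ᵐ ω ∂P, HasEmpiricalLaw (fun n => X n ω) (P.map (X 0)) := by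
  have := Measure.isProbabilityMeasure_map (μ := P) (hR.claims.measurable 0).aemeasurable
  have h := ae_hasEmpiricalLaw (P.map (X 0))
  rw [← hR.map_claims_eq] at h
  exact ae_of_ae_map hR.claims.measurable_seq.aemeasurable h

variable [MeasurableSpace.CountablyGenerated 𝓓] [MeasurableSpace.SeparatesPoints 𝓓]

/-- Under almost every `κ θ`, interarrival times and claim sizes are independent i.i.d. sequences
and the parameter is constant. -/
lemma ae_map_eq_prod_dirac {R : Measure Ω} [IsProbabilityMeasure P] {κ : 𝓓 → Measure Ω}
    {K : Kernel 𝓓 ℝ} [IsMarkovKernel K] (hΘ : Measurable Θ) (hP : MemClass R N X Θ K P)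
    (hκ : IsConsistentRCP P Θ κ) :
    ∀ᵐ θ ∂(P.map Θ),
      (κ θ).map (fun ω => ((fun n => interarrival N n ω, fun n => X n ω), Θ ω))
        = ((Measure.infinitePi fun _ : ℕ => K θ).prod
            (Measure.infinitePi fun _ : ℕ => P.map (X 0))).map fun p => (p, θ) := by
  have hW := hP.cmrp.2.counting.measurable_interarrival
  have hX := hP.cmrp.1.claims.measurable_seq
  filter_upwards [hκ.ae_map_prod_eq_of_condIndepPair hΘ hW hX hP.condIndepWX,
    hκ.ae_map_eq_of_indepFun hΘ hX hP.indepThetaX, hP.cmrp.2.ae_map_interarrival_eq hκ hΘ,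
    hκ.ae_param_eq hΘ] with θ h1 h2 h3 h4
  rw [← h3, ← hP.cmrp.1.map_claims_eq, ← h2, ← h1,
    Measure.map_map measurable_prodMk_right (hW.prodMk hX)]
  -- Under `κ θ` the variable `Θ` is almost surely the constant `θ`, so it may be replaced in the
  -- triple.
  refine Measure.map_congr ?_
  filter_upwards [h4] with ω hω
  simp [hω]

/-- The interarrival times almost surely have empirical law `K(Θ)`. -/
lemma ae_hasEmpiricalLaw_interarrival [IsProbabilityMeasure P] {κ : 𝓓 → Measure Ω}
    {K : Kernel 𝓓 ℝ} [IsMarkovKernel K] (hΘ : Measurable Θ) (hN : IsMRP P N Θ K)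
    (hκ : IsConsistentRCP P Θ κ) :
    ∀ᵐ ω ∂P, HasEmpiricalLaw (fun n => interarrival N n ω) (K (Θ ω)) := by
  have hW := hN.counting.measurable_interarrival
  -- Passing to `κ θ` freezes the random law `K (Θ ω)` at `K θ`, and the strong law for an i.i.d.
  -- sequence applies.
  refine hκ.ae_of_ae_ae (measurableSet_hasEmpiricalLaw hW fun s hs =>
    ((K.measurable_coe hs).comp hΘ).ennreal_toReal) ?_
  filter_upwards [hN.ae_map_interarrival_eq hκ hΘ, hκ.ae_param_eq hΘ] with θ h1 h2
  have h3 := ae_hasEmpiricalLaw (K θ)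
  rw [← h1] at h3
  filter_upwards [h2, ae_of_ae_map hW.aemeasurable h3] with ω h4 h5
  rwa [h4]

/-- Two compound mixed renewal laws with different disintegrations are mutually singular. -/
lemma singularOn_of_ae_not_eqOn [IsProbabilityMeasure P] [IsProbabilityMeasure Q]
    {K L : Kernel 𝓓 ℝ} [IsMarkovKernel K] [IsMarkovKernel L] (hΘ : Measurable Θ)
    (hP : MemClass P N X Θ K P) (hκP : IsConsistentRCP P Θ κP)
    (hQ : MemClass P N X Θ L Q) (hκQ : IsConsistentRCP Q Θ κQ)
    (h : ∀ᵐ θ ∂(P.map Θ), ¬ EqOn (κP θ) (κQ θ) (filtInf (aggregate N X) Θ)) :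
    SingularOn P Q (filtInf (aggregate N X) Θ) := by
  have hN := hP.cmrp.2.counting
  have hX := hP.cmrp.1.claims
  obtain ⟨hPQ, hQP⟩ := hQ.map_absolutelyContinuous hΘ
  have hle := filtInf_aggregate_le hN hX hΘ
  have hS := measurable_filtInf_apply (aggregate N X) Θ
  have := Measure.isProbabilityMeasure_map (μ := P) (hX.measurable 0).aemeasurable
  have := Measure.isProbabilityMeasure_map (μ := Q) (hX.measurable 0).aemeasurable
  -- With equal claim laws only the interarrival times can distinguish the measures; otherwise the
  -- claims alone do.
  by_cases hlaw : P.map (X 0) = Q.map (X 0)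
  · refine singularOn_of_ae hle (p := fun ω =>
      HasEmpiricalLaw (fun n => interarrival N n ω) (K (Θ ω))) ?_
      (ae_hasEmpiricalLaw_interarrival hΘ hP.cmrp.2 hκP) ?_
    · exact @measurableSet_hasEmpiricalLaw _ (filtInf (aggregate N X) Θ) _ _ (measurable_interarrival_of_aggregate hN hX.pos hS)
        fun s hs => (Measurable.comp (K.measurable_coe hs)
          (measurable_filtInf_param (aggregate N X) Θ)).ennreal_toReal
    -- If `K θ = L θ`, the triple of interarrival times, claims and parameter would have the same
    -- law under `κP θ` and `κQ θ`, which would then agree on 𝓕_∞.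
    · have hne : ∀ᵐ θ ∂(Q.map Θ), K θ ≠ L θ := by
        filter_upwards [hQP.ae_le h, hQP.ae_le (ae_map_eq_prod_dirac hΘ hP hκP),
          ae_map_eq_prod_dirac hΘ hQ hκQ] with θ h1 h2 h3 heq
        exact h1 (eqOn_filtInf_of_map_eq hN hX hΘ (by rw [h2, h3, heq, hlaw]))
      filter_upwards [ae_of_ae_map hΘ.aemeasurable hne,
        ae_hasEmpiricalLaw_interarrival hΘ hQ.cmrp.2 hκQ] with ω h1 h2 h3
      exact h1 (h3.unique h2)
  · refine singularOn_of_ae hle (p := fun ω => HasEmpiricalLaw (fun n => X n ω) (P.map (X 0)))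
      ?_ hP.cmrp.1.ae_hasEmpiricalLaw_claims ?_
    · exact @measurableSet_hasEmpiricalLaw _ (filtInf (aggregate N X) Θ) _ _ (measurable_claims_of_aggregate hN hX.pos hS)
        fun s _ => measurable_const
    · filter_upwards [hQ.cmrp.1.ae_hasEmpiricalLaw_claims] with ω h2 h3
      exact hlaw (h3.unique h2)

end Main
end CMRP

end

theorem mainTheorem7 {Ω : Type*} [MeasurableSpace Ω] (P : Measure Ω) [IsProbabilityMeasure P]
    {d k : ℕ} (D : Set (Fin d → ℝ)) (D' : Set (Fin k → ℝ))
    (Θ : Ω → D) (hΘ : Measurable Θ)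
    (N : ℝ≥0 → Ω → ℕ∞) (X : ℕ → Ω → ℝ)
    (K : Kernel D ℝ) [IsMarkovKernel K] (hP : CMRP.MemClass P N X Θ K P)
    (κP : D → Measure Ω) (hκP : CMRP.IsConsistentRCP P Θ κP)
    (Λ : Kernel D' ℝ) [IsMarkovKernel Λ] (ρ : D → D') (hρ : Measurable ρ)
    (Q : Measure Ω) (hQ : CMRP.MemClass P N X Θ (Λ.comap ρ hρ) Q)
    (κQ : D → Measure Ω) (hκQ : CMRP.IsConsistentRCP Q Θ κQ) :
    ((∀ᵐ θ ∂(P.map Θ),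
        CMRP.EqOn (κP θ) (κQ θ) (CMRP.filtInf (CMRP.aggregate N X) Θ)) →
      CMRP.EquivOn P Q (CMRP.filtInf (CMRP.aggregate N X) Θ)) ∧
    ((∀ᵐ θ ∂(P.map Θ),
        ¬ CMRP.EqOn (κP θ) (κQ θ) (CMRP.filtInf (CMRP.aggregate N X) Θ)) →
      CMRP.SingularOn P Q (CMRP.filtInf (CMRP.aggregate N X) Θ)) := by
  have hQprob := hQ.isProb
  obtain ⟨hPQ, hQP⟩ := hQ.map_absolutelyContinuous hΘ
  exact ⟨CMRP.equivOn_of_ae_eqOn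
      (CMRP.filtInf_aggregate_le hP.cmrp.2.counting hP.cmrp.1.claims hΘ) hκP hκQ hPQ hQP,
    CMRP.singularOn_of_ae_not_eqOn hΘ hP hκP hQ hκQ⟩
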